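/- For a compact set $S\subset\mathbb R$ let $B_S$ denote the Bernstein space of all bounded continuous functions $f:\mathbb R\to\mathbb C$, with the sup-norm, which are Fourier transforms of Schwartz distributions supported by $S$ (with the kernel $e^{itx}$). For $\Lambda\subset\mathbb R$ put $\gamma(\Lambda)=\inf\{|\lambda-\lambda'|:\lambda,\lambda'\in\Lambda,\ \lambda\neq\lambda'\}$ (with $\inf\emptyset=+\infty$); $\Lambda$ is uniformly discrete if $\gamma(\Lambda)>0$. For $\xi\in\Lambda$ let $\delta_\xi$ be the function on $\Lambda$ with $\delta_\xi(\xi)=1$ and $\delta_\xi(\lambda)=0$ for $\lambda\ne\xi$. Given a number $0<d<1$ and a uniformly discrete set $\Lambda\subset\mathbb R$, there exist a compact set $S\subset\mathbb R$ of Lebesgue measure zero and functions $f_\xi\in B_S$, $\xi\in\Lambda$, such that $\sup_{\xi\in\Lambda}\|f_\xi\|_\infty<\infty$ and $$\|f_\xi|_\Lambda-\delta_\xi\|_{\ell^\infty(\Lambda)}\le d\quad\text{for every }\xi\in\Lambda.$$ Moreover, the set $S$ can be chosen depending only on $d$ and the separation constant: for all $0<d<1$ and $0<\gamma\le+\infty$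 there is a single compact set $S$ of measure zero that works for every $\Lambda$ with $\gamma(\Lambda)\ge\gamma$. -/

import Mathlib

open MeasureTheory BoundedContinuousFunction
open scoped ENNReal FourierTransform SchwartzMap

noncomputable section

/-- The dilation `t ↦ -t / (2π)` of the real line. It relates the kernel `exp (-2πixξ)` of Mathlib's
Fourier transform to the kernel `exp (itx)`. -/
def fourierDilation : ℝ ≃L[ℝ] ℝ :=
  ContinuousLinearEquiv.unitsEquivAut ℝ
    (Units.mk0 (-(2 * Real.pi)⁻¹) (neg_ne_zero.mpr (inv_ne_zero Real.two_pi_pos.ne')))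

/-- The Fourier transform `φ̂(t) = ∫ exp(itx) φ(x) dx` of a Schwartz function, as a Schwartz
function. -/
def expFourier (φ : 𝓢(ℝ, ℂ)) : 𝓢(ℝ, ℂ) :=
  SchwartzMap.compCLMOfContinuousLinearEquiv ℂ fourierDilation (𝓕 φ)

/-- `expFourier` is indeed the Fourier transform with kernel `exp (itx)`. -/
theorem expFourier_apply (φ : 𝓢(ℝ, ℂ)) (t : ℝ) :
    expFourier φ t = ∫ x : ℝ, Complex.exp (Complex.I * t * x) * φ x := by
  have h1 : expFourier φ t = (𝓕 (φ : ℝ → ℂ)) (fourierDilation t) := by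
    rw [← SchwartzMap.fourier_coe]; rfl
  have h2 : fourierDilation t = t * (-(2 * Real.pi)⁻¹) := rfl
  rw [h1, h2, Real.fourier_real_eq_integral_exp_smul]
  refine integral_congr_ae (Filter.Eventually.of_forall fun x => ?_)
  have h3 : -2 * Real.pi * x * (t * (-(2 * Real.pi)⁻¹)) = t * x := by
    have := Real.pi_ne_zero
    field_simp
  simp only [smul_eq_mul, h3]
  congr 2
  push_cast
  ring

/-- `f` is the Fourier transform of the tempered distribution `u`: `⟨f, φ⟩ = ⟨u, φ̂⟩` for all
Schwartz functions `φ`, where `φ̂(t) = ∫ exp(itx) φ(x) dx`. -/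
def IsFourierTransformOf (f : ℝ → ℂ) (u : 𝓢'(ℝ, ℂ)) : Prop :=
  ∀ φ : 𝓢(ℝ, ℂ), ∫ x : ℝ, f x * φ x = u (expFourier φ)

/-- The Bernstein space `B_S` of a compact set `S`: the bounded (continuous) functions on the line
that are Fourier transforms of Schwartz distributions supported by `S`. Its norm is the sup-norm
of `ℝ →ᵇ ℂ`. -/
def bernsteinSpace (S : Set ℝ) : Set (ℝ →ᵇ ℂ) :=
  {f | ∃ u : 𝓢'(ℝ, ℂ), Distribution.dsupport u ⊆ S ∧ IsFourierTransformOf f u}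

/-- The restriction `f|_Λ` of a bounded function to `Λ`, as an element of `ℓ^∞(Λ)`. -/
def restrictLinfty (Λ : Set ℝ) (f : ℝ →ᵇ ℂ) : lp (fun _ : Λ => ℂ) ∞ :=
  ⟨fun l => f l, memℓp_infty ⟨‖f‖, by rintro _ ⟨l, rfl⟩; exact f.norm_coe_le_norm _⟩⟩

open Classical in
/-- The function `δ_ξ` on `Λ`, equal to `1` at `ξ` and to `0` elsewhere, in `ℓ^∞(Λ)`. -/
def deltaLinfty (Λ : Set ℝ) (ξ : Λ) : lp (fun _ : Λ => ℂ) ∞ :=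
  lp.single ∞ ξ (1 : ℂ)

end

noncomputable section

/-! It suffices to find a probability measure μ on a compact null set `S` whose Fourier transform is
at most `d` in modulus for |x| ≥ r, with 0 < r ≤ γ: then `f_ξ(x) = μ̂(x - ξ)` is bounded by 1,
equals 1 at ξ and is at most `d` at the other points of Λ.

Take for `S` the scaled Cantor set of base `m + 1` expansions that avoid the digit `m`, and for μ
the law of independent uniform digits, that is, the image of an invariant measure on `(ℤ/m)^ℕ`.
Averaging over one digit bounds |μ̂(x)| by a normalized geometric sum with ratio `exp(i x c
(m+1)⁻ᵏ)`, for any `k` (`card_mul_norm_integral_cantorMap_le`). Passing from `k + 1` to `k` raises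
the ratio to the power `m + 1`. Of two consecutive sums at a well-chosen scale, one is small
(`norm_geom_sum_le_or`): since a single digit is missing, `m` can be taken large in terms of `d`
alone. -/

theorem integrable_of_continuous_compactSpace {Ω : Type*} [TopologicalSpace Ω] [CompactSpace Ω]
    [MeasurableSpace Ω] [BorelSpace Ω] (P : Measure Ω) [IsFiniteMeasure P] {g : Ω → ℂ}
    (hg : Continuous g) : Integrable g P :=
  (BoundedContinuousFunction.mkOfCompact ⟨g, hg⟩).integrable P

theorem continuous_cexp_mul {Ω : Type*} [TopologicalSpace Ω] (x : ℝ) (X : C(Ω, ℝ)) :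
    Continuous fun ω => Complex.exp (Complex.I * x * X ω) := by
  fun_prop

theorem norm_cexp_I_mul_ofReal_mul (x y : ℝ) : ‖Complex.exp (Complex.I * x * y)‖ = 1 := by
  rw [mul_assoc, ← Complex.ofReal_mul, Complex.norm_exp_I_mul_ofReal]

theorem norm_integral_cexp_mul_le {Ω : Type*} [TopologicalSpace Ω] [CompactSpace Ω]
    [MeasurableSpace Ω] (P : Measure Ω) [IsProbabilityMeasure P] (X : C(Ω, ℝ)) (g : C(Ω, ℂ)) (x : ℝ) :
    ‖∫ ω, Complex.exp (Complex.I * x * X ω) * g ω ∂P‖ ≤ ‖g‖ := by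
  have h : ∀ ω, ‖Complex.exp (Complex.I * x * X ω) * g ω‖ ≤ ‖g‖ := fun ω => by
    rw [norm_mul, norm_cexp_I_mul_ofReal_mul, one_mul]
    exact g.norm_coe_le_norm ω
  simpa using norm_integral_le_of_norm_le_const (μ := P) (Filter.Eventually.of_forall h)

/-! ### Fourier transforms of measures carried by a compact image -/

section FourierIntegral

variable {Ω : Type*} [TopologicalSpace Ω] [CompactSpace Ω] [MeasurableSpace Ω] [BorelSpace Ω]
  (P : Measure Ω) [IsProbabilityMeasure P]

/-- The distribution `φ ↦ ∫ g(ω) φ(X(ω)) dP(ω)`: the image under `X` of the complex measure with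
density `g`. -/
def imageDistribution (X : C(Ω, ℝ)) (g : C(Ω, ℂ)) : 𝓢'(ℝ, ℂ) :=
  ContinuousLinearMap.toPointwiseConvergenceCLM _ _ _ _
    (SchwartzMap.mkCLMtoNormedSpace (𝕜 := ℂ) (σ := RingHom.id ℂ)
      (fun φ : 𝓢(ℝ, ℂ) => ∫ ω, g ω * φ (X ω) ∂P)
      (fun φ ψ => by
        have h (φ : 𝓢(ℝ, ℂ)) : Integrable (fun ω => g ω * φ (X ω)) P :=
          integrable_of_continuous_compactSpace P
            (g.continuous.mul (φ.continuous.comp X.continuous))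
        simp only [_root_.add_apply, mul_add]
        exact integral_add (h φ) (h ψ))
      (fun a φ => by
        simp only [_root_.smul_apply, smul_eq_mul, RingHom.id_apply, mul_left_comm _ a]
        exact integral_const_mul a _)
      ⟨{(0, 0)}, ‖g‖, norm_nonneg _, fun φ => by
        have h : ∀ ω, ‖g ω * φ (X ω)‖ ≤ ‖g‖ * SchwartzMap.seminorm ℂ 0 0 φ := fun ω => by
          rw [norm_mul]
          exact mul_le_mul (g.norm_coe_le_norm ω) (SchwartzMap.norm_le_seminorm ℂ φ _)
            (norm_nonneg _) (norm_nonneg _)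
        simpa [schwartzSeminormFamily] using
          norm_integral_le_of_norm_le_const (μ := P) (Filter.Eventually.of_forall h)⟩)

theorem imageDistribution_apply (X : C(Ω, ℝ)) (g : C(Ω, ℂ)) (φ : 𝓢(ℝ, ℂ)) :
    imageDistribution P X g φ = ∫ ω, g ω * φ (X ω) ∂P := rfl

theorem dsupport_imageDistribution_subset (X : C(Ω, ℝ)) (g : C(Ω, ℂ)) :
    Distribution.dsupport (imageDistribution P X g) ⊆ Set.range X := by
  refine Set.sInter_subset_of_mem ⟨fun φ hφ => ?_, (isCompact_range X.continuous).isClosed⟩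
  rw [imageDistribution_apply]
  have h : ∀ ω, g ω * φ (X ω) = 0 := fun ω => by
    rw [image_eq_zero_of_notMem_tsupport (f := φ) fun hmem => hφ hmem ⟨ω, rfl⟩, mul_zero]
  simp [h]

/-- The Fourier transform `x ↦ ∫ exp(i x X(ω)) g(ω) dP(ω)` of `imageDistribution P X g`, as a
bounded continuous function. -/
def fourierIntegralBCF (X : C(Ω, ℝ)) (g : C(Ω, ℂ)) : ℝ →ᵇ ℂ :=
  BoundedContinuousFunction.ofNormedAddCommGroup
    (fun x : ℝ => ∫ ω, Complex.exp (Complex.I * x * X ω) * g ω ∂P)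
    (continuous_of_dominated (bound := fun _ => ‖g‖)
      (fun x => ((continuous_cexp_mul x X).mul g.continuous).aestronglyMeasurable)
      (fun x => Filter.Eventually.of_forall fun ω => by
        rw [norm_mul, norm_cexp_I_mul_ofReal_mul, one_mul]
        exact g.norm_coe_le_norm ω)
      (integrable_const _)
      (Filter.Eventually.of_forall fun ω => by fun_prop))
    ‖g‖ (norm_integral_cexp_mul_le P X g)

theorem fourierIntegralBCF_apply (X : C(Ω, ℝ)) (g : C(Ω, ℂ)) (x : ℝ) :
    fourierIntegralBCF P X g x = ∫ ω, Complex.exp (Complex.I * x * X ω) * g ω ∂P := rfl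

theorem norm_fourierIntegralBCF_le (X : C(Ω, ℝ)) (g : C(Ω, ℂ)) :
    ‖fourierIntegralBCF P X g‖ ≤ ‖g‖ :=
  BoundedContinuousFunction.norm_ofNormedAddCommGroup_le _ (norm_nonneg _) _

variable [SecondCountableTopology Ω] in
theorem isFourierTransformOf_imageDistribution (X : C(Ω, ℝ)) (g : C(Ω, ℂ)) :
    IsFourierTransformOf (fourierIntegralBCF P X g) (imageDistribution P X g) := by
  intro φ
  have hint : Integrable
      (Function.uncurry fun (x : ℝ) ω => Complex.exp (Complex.I * x * X ω) * g ω * φ x)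
      (volume.prod P) := by
    have h1 : Integrable (fun z : ℝ × Ω => φ z.1) (volume.prod P) :=
      φ.integrable.comp_fst P
    refine h1.bdd_mul (c := ‖g‖) ?_ (Filter.Eventually.of_forall fun z => ?_)
    · exact Continuous.aestronglyMeasurable (by fun_prop)
    · rw [norm_mul, norm_cexp_I_mul_ofReal_mul, one_mul]
      exact g.norm_coe_le_norm _
  calc ∫ x : ℝ, fourierIntegralBCF P X g x * φ x
      = ∫ x : ℝ, ∫ ω, Complex.exp (Complex.I * x * X ω) * g ω * φ x ∂P := by
        simp only [fourierIntegralBCF_apply, integral_mul_const]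
    _ = ∫ ω, (∫ x : ℝ, Complex.exp (Complex.I * x * X ω) * g ω * φ x) ∂P :=
        integral_integral_swap hint
    _ = imageDistribution P X g (expFourier φ) := by
        rw [imageDistribution_apply]
        congr 1 with ω
        rw [expFourier_apply, ← integral_const_mul]
        congr 1 with x
        ring_nf

variable [SecondCountableTopology Ω] in
theorem fourierIntegralBCF_mem_bernsteinSpace (X : C(Ω, ℝ)) (g : C(Ω, ℂ)) :
    fourierIntegralBCF P X g ∈ bernsteinSpace (Set.range X) :=
  ⟨imageDistribution P X g, dsupport_imageDistribution_subset P X g,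
    isFourierTransformOf_imageDistribution P X g⟩

end FourierIntegral

/-! ### Two consecutive geometric sums -/

section GeometricSums

/-- If `w ^ (m + 1)` is far from 1, the second sum is small by the closed formula. Otherwise `w`,
being away from 1, nearly satisfies `1 + w + ⋯ + w ^ m = 0`, so the first sum is close to `-w ^ m`,
of modulus 1, up to an error of order `1 / d`. Both bounds fit under `d * m` once `m ≥ 3 / d ^ 2`.
-/
theorem norm_geom_sum_le_or {w : ℂ} (hw : ‖w‖ = 1) {m : ℕ} {d : ℝ} (hd0 : 0 < d) (hd1 : d < 1)
    (hm : 3 / d ^ 2 ≤ m) (hw1 : 2 / ((m : ℝ) + 1) ≤ ‖w - 1‖) :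
    ‖∑ j ∈ Finset.range m, w ^ j‖ ≤ d * m ∨
      ‖∑ j ∈ Finset.range m, (w ^ (m + 1)) ^ j‖ ≤ d * m := by
  have hdm : 3 ≤ d * (d * m) := by
    rw [div_le_iff₀ (by positivity)] at hm
    linarith
  have hm0 : (1 : ℝ) ≤ m := by
    rcases Nat.eq_zero_or_pos m with rfl | h
    · norm_num at hdm
    · exact_mod_cast h
  have hpow (n : ℕ) : ‖w ^ n‖ = 1 := by rw [norm_pow, hw, one_pow]
  set E := ‖∑ j ∈ Finset.range m, w ^ j‖ with hE
  set F := ‖∑ j ∈ Finset.range m, (w ^ (m + 1)) ^ j‖ with hF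
  set δ := ‖w ^ (m + 1) - 1‖ with hδ
  have hFδ : F * δ ≤ 2 := by
    rw [hF, hδ, ← norm_mul, geom_sum_mul]
    refine (norm_sub_le _ _).trans ?_
    rw [← pow_mul, hpow, norm_one]
    norm_num
  have hEw : E * ‖w - 1‖ ≤ δ + ‖w - 1‖ := by
    rw [hE, hδ, ← norm_mul, geom_sum_mul]
    -- The sum of `m` terms is the full sum of `m + 1` terms minus `w ^ m`, whence `E ≤ 1 + δ / ‖w -
    -- 1‖`.
    have h : w ^ m - 1 = (w ^ (m + 1) - 1) - w ^ m * (w - 1) := by ring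
    rw [h]
    refine (norm_sub_le _ _).trans ?_
    rw [norm_mul, hpow, one_mul]
  have hδ0 : 0 ≤ δ := norm_nonneg _
  by_cases h : 2 ≤ d * m * δ
  · right
    have hδ' : 0 < δ := lt_of_le_of_ne hδ0 fun h0 => by rw [← h0] at h; norm_num at h
    exact le_of_mul_le_mul_right (hFδ.trans h) hδ'
  · left
    by_contra! hlt
    have hdm1 : 3 ≤ d * m := hdm.trans (mul_le_of_le_one_left (by positivity) hd1.le)
    have h1 : (E - 1) * (2 / ((m : ℝ) + 1)) ≤ δ :=
      (mul_le_mul_of_nonneg_left hw1 (by linarith)).trans (by linarith)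
    rw [mul_div_assoc', div_le_iff₀ (by positivity)] at h1
    have h2 : E - 1 ≤ δ * m := by nlinarith
    have h3 : d * (E - 1) ≤ d * (δ * m) := mul_le_mul_of_nonneg_left h2 hd0.le
    have h4 : d * (d * m) < d * E := mul_lt_mul_of_pos_left hlt hd0
    nlinarith

/-- The chord has length `2 |sin (θ / 2)|`, and Jordan's inequality bounds the sine from below. -/
theorem two_div_pi_mul_abs_le_norm_cexp_sub_one {θ : ℝ} (hθ : |θ| ≤ Real.pi) :
    2 / Real.pi * |θ| ≤ ‖Complex.exp (Complex.I * θ) - 1‖ := by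
  rw [Complex.norm_exp_I_mul_ofReal_sub_one, norm_mul, Real.norm_eq_abs, Real.norm_eq_abs, abs_two]
  have h : |θ / 2| = |θ| / 2 := by rw [abs_div, abs_two]
  have := Real.mul_abs_le_abs_sin (x := θ / 2) (by rw [h]; linarith)
  rw [h] at this
  linarith

end GeometricSums

/-! ### The Cantor set and the decay of its measure -/

section CantorSet

variable (m : ℕ) [NeZero m] (c : ℝ)

theorem norm_cantorTerm_le (k : ℕ) (ω : ℕ → ZMod m) :
    ‖c * (ω k).val * ((m : ℝ) + 1)⁻¹ ^ k‖ ≤ |c| * m * ((m : ℝ) + 1)⁻¹ ^ k := by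
  rw [norm_mul, norm_mul, Real.norm_eq_abs, Real.norm_natCast,
    Real.norm_of_nonneg (by positivity)]
  gcongr
  exact (ZMod.val_lt _).le

theorem summable_cantorBound : Summable fun k : ℕ => |c| * m * ((m : ℝ) + 1)⁻¹ ^ k := by
  have hm : (0 : ℝ) < m := by exact_mod_cast NeZero.pos m
  refine (summable_geometric_of_lt_one (by positivity) ?_).mul_left _
  exact inv_lt_one_of_one_lt₀ (by linarith)

theorem summable_cantorTerm (ω : ℕ → ZMod m) :
    Summable fun k : ℕ => c * (ω k).val * ((m : ℝ) + 1)⁻¹ ^ k :=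
  Summable.of_norm_bounded (summable_cantorBound m c) fun k => norm_cantorTerm_le m c k ω

/-- The map `ω ↦ c ∑ₖ ωₖ (m + 1)⁻ᵏ`. Its range is a Cantor set: the expansions in base `m + 1` that
avoid the digit `m`. -/
def cantorMap : C(ℕ → ZMod m, ℝ) where
  toFun ω := ∑' k, c * (ω k).val * ((m : ℝ) + 1)⁻¹ ^ k
  continuous_toFun := by
    refine continuous_tsum (fun k => ?_) (summable_cantorBound m c) (norm_cantorTerm_le m c)
    have h : Continuous fun a : ZMod m => (a.val : ℝ) := continuous_of_discreteTopology
    exact (continuous_const.mul (h.comp (continuous_apply k))).mul continuous_const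

theorem cantorMap_apply (ω : ℕ → ZMod m) :
    cantorMap m c ω = ∑' k, c * (ω k).val * ((m : ℝ) + 1)⁻¹ ^ k := rfl

theorem cantorMap_eq_add_shift (ω : ℕ → ZMod m) :
    cantorMap m c ω =
      c * (ω 0).val + ((m : ℝ) + 1)⁻¹ * cantorMap m c (fun k => ω (k + 1)) := by
  rw [cantorMap_apply, (summable_cantorTerm m c ω).tsum_eq_zero_add, cantorMap_apply,
    ← tsum_mul_left]
  congr 1
  · simp
  · congr 1 with k
    ring

/-- Addition in `ℤ/m` has no carries, so a translation in coordinate `k` changes only that digit. -/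
theorem cantorMap_add_single (ω : ℕ → ZMod m) (k : ℕ) (j : ZMod m) :
    cantorMap m c (ω + Pi.single k j) =
      cantorMap m c ω - c * (ω k).val * ((m : ℝ) + 1)⁻¹ ^ k +
        c * (ω k + j).val * ((m : ℝ) + 1)⁻¹ ^ k := by
  have h : cantorMap m c (ω + Pi.single k j) - cantorMap m c ω =
      c * (ω k + j).val * ((m : ℝ) + 1)⁻¹ ^ k - c * (ω k).val * ((m : ℝ) + 1)⁻¹ ^ k := by
    rw [cantorMap_apply, cantorMap_apply,
      ← (summable_cantorTerm m c _).tsum_sub (summable_cantorTerm m c ω), tsum_eq_single k]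
    · simp
    · intro i hi
      simp [Pi.single_eq_of_ne hi]
  linarith

open scoped Pointwise in
theorem range_cantorMap_subset :
    Set.range (cantorMap m c) ⊆ ⋃ a : ZMod m,
      (c * (a.val : ℝ)) +ᵥ (((m : ℝ) + 1)⁻¹ • Set.range (cantorMap m c)) := by
  rintro _ ⟨ω, rfl⟩
  refine Set.mem_iUnion.2 ⟨ω 0, ?_⟩
  rw [cantorMap_eq_add_shift]
  exact Set.vadd_mem_vadd_set (Set.smul_mem_smul_set ⟨_, rfl⟩)

/-- Self-similarity: `m` copies scaled by `1 / (m + 1)` cover the set, so its finite volume `v`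
satisfies `v ≤ m / (m + 1) * v`. -/
theorem volume_range_cantorMap : volume (Set.range (cantorMap m c)) = 0 := by
  have hfin : volume (Set.range (cantorMap m c)) ≠ ∞ :=
    (isCompact_range (cantorMap m c).continuous).measure_lt_top.ne
  have hle := (measure_mono (μ := volume) (range_cantorMap_subset m c)).trans
    (measure_iUnion_fintype_le _ _)
  simp only [measure_vadd, Measure.addHaar_smul, Module.finrank_self, pow_one, Finset.sum_const,
    Finset.card_univ, ZMod.card, nsmul_eq_mul] at hle
  have hreal := ENNReal.toReal_mono
    (ENNReal.mul_ne_top (ENNReal.natCast_ne_top m) (ENNReal.mul_ne_top ENNReal.ofReal_ne_top hfin))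
    hle
  rw [ENNReal.toReal_mul, ENNReal.toReal_mul, ENNReal.toReal_natCast,
    ENNReal.toReal_ofReal (abs_nonneg _), abs_of_pos (by positivity)] at hreal
  set v := (volume (Set.range (cantorMap m c))).toReal with hv
  have hv0 : 0 ≤ v := ENNReal.toReal_nonneg
  have hmul : v * ((m : ℝ) + 1) ≤ m * v := by
    have := mul_le_mul_of_nonneg_right hreal (by positivity : (0 : ℝ) ≤ m + 1)
    field_simp at this
    linarith
  have hv' : v = 0 := by nlinarith
  exact ((ENNReal.toReal_eq_zero_iff _).1 hv').resolve_right hfin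

theorem sum_zmod_val_eq_sum_range (F : ℕ → ℂ) :
    ∑ a : ZMod m, F a.val = ∑ j ∈ Finset.range m, F j := by
  refine Finset.sum_bij (fun a _ => a.val) (fun a _ => Finset.mem_range.2 (ZMod.val_lt a))
    (fun a _ b _ h => ZMod.val_injective m h)
    (fun j hj => ⟨(j : ZMod m), Finset.mem_univ _, ZMod.val_cast_of_lt (Finset.mem_range.1 hj)⟩)
    (fun _ _ => rfl)

variable (P : Measure (ℕ → ZMod m)) [IsProbabilityMeasure P] [P.IsAddRightInvariant]

/-- By invariance the integrand may be averaged over the translates of digit `k`. With the other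
digits fixed, this average is a unimodular factor times the geometric sum, whose modulus does not
depend on them. -/
theorem card_mul_norm_integral_cantorMap_le (x : ℝ) (k : ℕ) :
    m * ‖∫ ω, Complex.exp (Complex.I * x * cantorMap m c ω) ∂P‖ ≤
      ‖∑ j ∈ Finset.range m,
        Complex.exp (Complex.I * (x * c * ((m : ℝ) + 1)⁻¹ ^ k : ℝ)) ^ j‖ := by
  set w := Complex.exp (Complex.I * (x * c * ((m : ℝ) + 1)⁻¹ ^ k : ℝ)) with hw
  set G : (ℕ → ZMod m) → ℂ := fun ω => Complex.exp (Complex.I * x * cantorMap m c ω) with hG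
  have hGi : Integrable G P :=
    integrable_of_continuous_compactSpace P (continuous_cexp_mul x (cantorMap m c))
  have hshift (ω : ℕ → ZMod m) (a : ZMod m) : G (ω + Pi.single k a) =
      Complex.exp (Complex.I * x *
        (cantorMap m c ω - c * (ω k).val * ((m : ℝ) + 1)⁻¹ ^ k : ℝ)) * w ^ (ω k + a).val := by
    rw [hG, hw, ← Complex.exp_nat_mul, ← Complex.exp_add]
    simp only [cantorMap_add_single]
    congr 1
    push_cast
    ring
  have hsum (ω : ℕ → ZMod m) : ‖∑ a : ZMod m, G (ω + Pi.single k a)‖ =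
      ‖∑ j ∈ Finset.range m, w ^ j‖ := by
    simp only [hshift]
    rw [← Finset.mul_sum, norm_mul, norm_cexp_I_mul_ofReal_mul, one_mul,
      ← sum_zmod_val_eq_sum_range m fun j => w ^ j]
    exact congrArg norm (Equiv.sum_comp (Equiv.addLeft (ω k)) fun a : ZMod m => w ^ a.val)
  have hint : (m : ℂ) * ∫ ω, G ω ∂P = ∫ ω, ∑ a : ZMod m, G (ω + Pi.single k a) ∂P := by
    rw [integral_finsetSum _ fun a _ => hGi.comp_add_right _]
    simp only [integral_add_right_eq_self, Finset.sum_const, Finset.card_univ, ZMod.card,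
      nsmul_eq_mul]
  calc (m : ℝ) * ‖∫ ω, G ω ∂P‖ = ‖(m : ℂ) * ∫ ω, G ω ∂P‖ := by
        rw [norm_mul, Complex.norm_natCast]
    _ ≤ ‖∑ j ∈ Finset.range m, w ^ j‖ := by
        rw [hint]
        simpa using norm_integral_le_of_norm_le_const (μ := P)
          (Filter.Eventually.of_forall fun ω => (hsum ω).le)

theorem norm_integral_cantorMap_le {d : ℝ} (hd0 : 0 < d) (hd1 : d < 1) (hm : 3 / d ^ 2 ≤ m)
    {x : ℝ} (hx : Real.pi ≤ |x * c|) :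
    ‖∫ ω, Complex.exp (Complex.I * x * cantorMap m c ω) ∂P‖ ≤ d := by
  have hm0 : (0 : ℝ) < m := by exact_mod_cast NeZero.pos m
  have hpi := Real.pi_pos
  -- This `k` puts the phase `θ` of digit `k + 1` in `π / (m + 1) ≤ |θ| ≤ π`, so that `exp(iθ)` is
  -- at distance at least `2 / (m + 1)` from 1; digit `k` has phase `(m + 1) θ`.
  obtain ⟨k, hk1, hk2⟩ := exists_nat_pow_near (x := |x * c| / Real.pi) (y := (m : ℝ) + 1)
    ((one_le_div hpi).2 hx) (by linarith)
  rw [le_div_iff₀ hpi] at hk1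
  rw [div_lt_iff₀ hpi] at hk2
  have hb : (0 : ℝ) < m + 1 := by positivity
  set θ := x * c * ((m : ℝ) + 1)⁻¹ ^ (k + 1) with hθ
  have habs : |θ| = |x * c| / ((m : ℝ) + 1) ^ (k + 1) := by
    rw [hθ, abs_mul, abs_of_pos (pow_pos (inv_pos.2 hb) _), inv_pow, div_eq_mul_inv]
  have hθle : |θ| ≤ Real.pi := by
    rw [habs, div_le_iff₀ (by positivity)]
    linarith
  have hθge : Real.pi / ((m : ℝ) + 1) ≤ |θ| := by
    rw [habs, div_le_div_iff₀ hb (by positivity), pow_succ]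
    nlinarith
  have hw1 : 2 / ((m : ℝ) + 1) ≤ ‖Complex.exp (Complex.I * θ) - 1‖ := by
    refine le_trans ?_ (two_div_pi_mul_abs_le_norm_cexp_sub_one hθle)
    calc 2 / ((m : ℝ) + 1) = 2 / Real.pi * (Real.pi / ((m : ℝ) + 1)) := by field_simp
      _ ≤ _ := by gcongr
  have hpow : Complex.exp (Complex.I * θ) ^ (m + 1) =
      Complex.exp (Complex.I * (x * c * ((m : ℝ) + 1)⁻¹ ^ k : ℝ)) := by
    have hθ' : (x * c * ((m : ℝ) + 1)⁻¹ ^ k : ℝ) = ((m : ℝ) + 1) * θ := by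
      rw [hθ, pow_succ]
      field_simp
    rw [← Complex.exp_nat_mul, hθ']
    congr 1
    push_cast
    ring
  have key : (m : ℝ) * ‖∫ ω, Complex.exp (Complex.I * x * cantorMap m c ω) ∂P‖ ≤ d * m := by
    rcases norm_geom_sum_le_or (Complex.norm_exp_I_mul_ofReal θ) hd0 hd1 hm hw1 with h | h
    · exact (card_mul_norm_integral_cantorMap_le m c P x (k + 1)).trans h
    · rw [hpow] at h
      exact (card_mul_norm_integral_cantorMap_le m c P x k).trans h
  rw [mul_comm] at key
  exact le_of_mul_le_mul_right key hm0

end CantorSet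

/-- A compact topological additive commutative group carries an invariant probability measure. -/
theorem exists_isProbabilityMeasure_isAddRightInvariant (G : Type*) [AddCommGroup G]
    [TopologicalSpace G] [IsTopologicalAddGroup G] [CompactSpace G] [MeasurableSpace G]
    [BorelSpace G] : ∃ P : Measure G, IsProbabilityMeasure P ∧ P.IsAddRightInvariant := by
  let μ : Measure G := Measure.addHaarMeasure ⊤
  refine ⟨μ, ⟨?_⟩, ⟨fun g => ?_⟩⟩
  · simpa using Measure.addHaarMeasure_self (K₀ := (⊤ : TopologicalSpace.PositiveCompacts G))
  · simpa only [add_comm] using map_add_left_eq_self μ g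

end

theorem proposition1 (d : ℝ) (hd0 : 0 < d) (hd1 : d < 1) (γ : ℝ≥0∞) (hγ : 0 < γ) :
    ∃ S : Set ℝ, IsCompact S ∧ volume S = 0 ∧
      ∀ Λ : Set ℝ, γ ≤ Λ.einfsep →
        ∃ f : Λ → (ℝ →ᵇ ℂ),
          (∀ ξ, f ξ ∈ bernsteinSpace S) ∧
          (∃ C : ℝ, ∀ ξ, ‖f ξ‖ ≤ C) ∧
          ∀ ξ, ‖restrictLinfty Λ (f ξ) - deltaLinfty Λ ξ‖ ≤ d := by
  obtain ⟨m, hm⟩ := exists_nat_ge (3 / d ^ 2)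
  have hm0 : m ≠ 0 := by
    rintro rfl
    have : 0 < 3 / d ^ 2 := by positivity
    norm_num at hm
    linarith
  have : NeZero m := ⟨hm0⟩
  have hγ1 : min γ 1 ≠ ∞ := ne_top_of_le_ne_top ENNReal.one_ne_top (min_le_right _ _)
  -- The minimum with 1 keeps `r` finite when `γ = ∞`; the scale `c = π / r` then turns `|x| ≥ r`
  -- into `|x * c| ≥ π`.
  set r := (min γ 1).toReal with hr
  have hr0 : 0 < r := ENNReal.toReal_pos (lt_min hγ one_pos).ne' hγ1
  set c := Real.pi / r with hc
  obtain ⟨P, hP, hPinv⟩ := exists_isProbabilityMeasure_isAddRightInvariant (ℕ → ZMod m)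
  refine ⟨Set.range (cantorMap m c), isCompact_range (cantorMap m c).continuous,
    volume_range_cantorMap m c, fun Λ hΛ => ?_⟩
  -- The density `exp(-iξX)` translates the Fourier transform by ξ without enlarging the support.
  let g (ξ : ℝ) : C(ℕ → ZMod m, ℂ) :=
    ⟨fun ω => Complex.exp (Complex.I * (-ξ : ℝ) * cantorMap m c ω), continuous_cexp_mul _ _⟩
  have happly (ξ x : ℝ) : fourierIntegralBCF P (cantorMap m c) (g ξ) x =
      ∫ ω, Complex.exp (Complex.I * (x - ξ : ℝ) * cantorMap m c ω) ∂P := by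
    rw [fourierIntegralBCF_apply]
    congr 1 with ω
    simp only [g, ContinuousMap.coe_mk, ← Complex.exp_add]
    congr 1
    push_cast
    ring
  refine ⟨fun ξ => fourierIntegralBCF P (cantorMap m c) (g ξ),
    fun ξ => fourierIntegralBCF_mem_bernsteinSpace P _ _, ⟨1, fun ξ => ?_⟩, fun ξ => ?_⟩
  · refine (norm_fourierIntegralBCF_le P _ _).trans ?_
    exact (ContinuousMap.norm_le _ zero_le_one).2 fun ω => (norm_cexp_I_mul_ofReal_mul _ _).le
  · refine lp.norm_le_of_forall_le hd0.le fun l => ?_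
    change ‖fourierIntegralBCF P (cantorMap m c) (g ξ) l - deltaLinfty Λ ξ l‖ ≤ d
    rw [happly]
    by_cases h : l = ξ
    · subst h
      simpa [deltaLinfty] using hd0.le
    · have hzero : deltaLinfty Λ ξ l = 0 := by
        simp [deltaLinfty, lp.single_apply, h]
      rw [hzero, sub_zero]
      refine norm_integral_cantorMap_le m c P hd0 hd1 hm ?_
      have hdist : γ ≤ edist (l : ℝ) ξ :=
        Set.le_edist_of_le_einfsep l.2 ξ.2 (fun h' => h (Subtype.ext h')) hΛ
      have hrle : r ≤ |(l : ℝ) - ξ| := by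
        rw [← Real.dist_eq, dist_edist]
        exact ENNReal.toReal_mono (edist_ne_top _ _) ((min_le_left _ _).trans hdist)
      rw [abs_mul, abs_of_pos (show 0 < c from div_pos Real.pi_pos hr0), hc, mul_div_assoc',
        le_div_iff₀ hr0, mul_comm]
      exact mul_le_mul_of_nonneg_right hrle Real.pi_pos.le
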